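/- **Theorem (instance-independent regret bound for the StableOpt variant).** *Setting.* There are $n$ arms $1,\dots,n$ and a nonempty family $\mathcal G$ of nonempty, possibly overlapping, subsets ("groups") of $\{1,\dots,n\}$. The rewards $X_{j,1},X_{j,2},\dots$ of successive pulls of arm $j$ are i.i.d. with mean $\mu_j\in[0,1]$ and are sub-Gaussian with a parameter $R\le\frac12$, i.e. $\mathbb E[e^{\lambda(X_{j,s}-\mu_j)}]\le e^{\lambda^2R^2/2}$ for all $\lambda\in\mathbb R$. The simple regret of a group $H\in\mathcal G$ is $$r(H)=\max_{G\in\mathcal G}\min_{j\in G}\mu_j-\min_{j\in H}\mu_j .$$ *Algorithm.* Let $\varepsilon\in(0,1)$ and $\delta\in(0,\frac{\log 2}{e})$ be parameters. For $k\ge1$ and $\delta'>0$ put $$U(k,\delta')=(1+\sqrt\varepsilon)\sqrt{\frac{1+\varepsilon}{2k}\log\frac{\log((1+\varepsilon)k)}{\delta'}}$$ (the square root of a negative number being read as $0$). Let $T_j(t)$ be the number of pulls of arm $j$ in rounds $1,\dots,t$. If $T_j(t)\ge1$, let $\hat\mu_{j}(t)$ be the mean of the $T_j(t)$ rewards observed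 from arm $j$ up to round $t$, and $$\mathrm{UCB}_t(j)=\hat\mu_j(t)+U\big(T_j(t),\tfrac{\delta}{n}\big),\qquad \mathrm{LCB}_t(j)=\hat\mu_j(t)-U\big(T_j(t),\tfrac{\delta}{n}\big);$$ if $T_j(t)=0$, let $\mathrm{UCB}_t(j)=1$ and $\mathrm{LCB}_t(j)=0$. In each round $t=1,2,\dots$ the algorithm chooses $$G_t\in\arg\max_{G\in\mathcal G}\min_{j\in G}\mathrm{UCB}_{t-1}(j),\qquad j_t\in\arg\min_{j\in G_t}\mathrm{LCB}_{t-1}(j),$$ and pulls arm $j_t$. After $T$ rounds it returns $G^{(T)}=G_{t^*}$, where $t^*\in\arg\max_{1\le t\le T}\min_{j\in G_t}\mathrm{LCB}_{t-1}(j)$. All ties are broken arbitrarily. *Claim.* For every $\varepsilon\in(0,1)$ there are constants $C,c>0$, depending only on $\varepsilon$, such that for every instance as above and every $\delta\in(0,\frac{\log2}{e})$ there is an event of probability at least $1-c\,\delta$ on which, however ties are broken, for all integers $T\ge2$, $$r(G^{(T)})\le C\,\sqrt{\frac nT}\,\Big(\sqrt{\log\frac n\delta}+\log\log T\Big).$$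 -/

import Mathlib

open MeasureTheory ProbabilityTheory
open scoped NNReal

namespace GroupedBandit

noncomputable section

/-- `min_{j ∈ G} f j`, the worst value of `f` on the group `G` (used for nonempty `G`). -/
def worst {n : ℕ} (f : Fin n → ℝ) (G : Finset (Fin n)) : ℝ := ⨅ j : G, f j

/-- The simple regret `max_{H ∈ 𝒢} min_{j ∈ H} μ j - min_{j ∈ G} μ j` of the group `G`. -/
def simpleRegret {n : ℕ} (𝒢 : Finset (Finset (Fin n))) (μ : Fin n → ℝ)
    (G : Finset (Fin n)) : ℝ :=
  (⨆ H : 𝒢, worst μ H) - worst μ G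

/-- The number `T_j(t)` of pulls of arm `j` in rounds `1, …, t`, where `a s` is the arm pulled in
round `s`. -/
def pulls {n : ℕ} (a : ℕ → Fin n) (t : ℕ) (j : Fin n) : ℕ :=
  ((Finset.Icc 1 t).filter (fun s => a s = j)).card

/-- The mean of the first `k` rewards of arm `j`; `x j s` is the reward of the `(s + 1)`-st pull
of arm `j`. -/
def empMean {n : ℕ} (x : Fin n → ℕ → ℝ) (j : Fin n) (k : ℕ) : ℝ :=
  (∑ s ∈ Finset.range k, x j s) / k

/-- The confidence width `U(k, δ)` for `k ≥ 1` samples. -/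
def width (ε : ℝ) (k : ℕ) (δ : ℝ) : ℝ :=
  (1 + √ε) * √((1 + ε) / (2 * k) * Real.log (Real.log ((1 + ε) * k) / δ))

/-- Upper confidence bound of arm `j` after round `t`; it is `1` while `j` has not been pulled. -/
def UCB {n : ℕ} (ε δ : ℝ) (x : Fin n → ℕ → ℝ) (a : ℕ → Fin n) (t : ℕ) (j : Fin n) : ℝ :=
  if pulls a t j = 0 then 1
  else empMean x j (pulls a t j) + width ε (pulls a t j) (δ / n)

/-- Lower confidence bound of arm `j` after round `t`; it is `0` while `j` has not been pulled. -/
def LCB {n : ℕ} (ε δ : ℝ) (x : Fin n → ℕ → ℝ) (a : ℕ → Fin n) (t : ℕ) (j : Fin n) : ℝ :=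
  if pulls a t j = 0 then 0
  else empMean x j (pulls a t j) - width ε (pulls a t j) (δ / n)

/-- The sequences of groups `G 1, G 2, …` and arms `a 1, a 2, …` form an execution of the
StableOpt variant on the reward table `x`, with ties broken in any way. The values `G 0` and `a 0`
play no role. -/
structure IsStableOptRun {n : ℕ} (𝒢 : Finset (Finset (Fin n))) (ε δ : ℝ) (x : Fin n → ℕ → ℝ)
    (G : ℕ → Finset (Fin n)) (a : ℕ → Fin n) : Prop where
  group_mem : ∀ t, 1 ≤ t → G t ∈ 𝒢
  group_argmax : ∀ t, 1 ≤ t → ∀ H ∈ 𝒢,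
    worst (UCB ε δ x a (t - 1)) H ≤ worst (UCB ε δ x a (t - 1)) (G t)
  arm_mem : ∀ t, 1 ≤ t → a t ∈ G t
  arm_argmin : ∀ t, 1 ≤ t → ∀ i ∈ G t, LCB ε δ x a (t - 1) (a t) ≤ LCB ε δ x a (t - 1) i

/-- `H` is a group `G t` returned after `T` rounds: `t ∈ {1, …, T}` maximizes
`min_{j ∈ G t} LCB_{t-1}(j)`. -/
def IsOutput {n : ℕ} (ε δ : ℝ) (x : Fin n → ℕ → ℝ) (G : ℕ → Finset (Fin n)) (a : ℕ → Fin n)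
    (T : ℕ) (H : Finset (Fin n)) : Prop :=
  ∃ t ∈ Finset.Icc 1 T, H = G t ∧ ∀ s ∈ Finset.Icc 1 T,
    worst (LCB ε δ x a (s - 1)) (G s) ≤ worst (LCB ε δ x a (t - 1)) (G t)

end

end GroupedBandit

/-! The probability enters only through `Concentrated`: every empirical mean, at every sample size,
lies within `width` of its true mean. On this event the argument is pathwise, so neither
tie-breaking nor the dependence of the pulls on the past matters. If arm `a t` is pulled in round
`t`, optimism in the choice of `G t` puts the optimal value below its UCB. Its LCB is the worst LCB
of `G t`, hence at most that of the output group, hence at most the true value of the output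
(`simpleRegret_le_UCB_sub_LCB`). The regret is thus at most twice the width of any arm at the moment
it is pulled. By pigeonhole some arm has at least `T / n` pulls; its last pull gives a width of
order `√(n / T)` up to logarithms (`exists_simpleRegret_le_width`, `width_le`). The event is likely
by a finite-sample iterated logarithm law (`measure_exists_width_lt_sum_le`): Doob's inequality on
geometric blocks of times, then a union bound over blocks, arms and both signs. -/

namespace GroupedBandit

/-! ### Maximal inequality for subgaussian random walks. -/

section Maximal

variable {Ω : Type*} [MeasurableSpace Ω] {P : Measure Ω}

lemma hasSubgaussianMGF_mono {Y : Ω → ℝ} {c c' : ℝ≥0} (hY : HasSubgaussianMGF Y c P)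
    (hc : c ≤ c') : HasSubgaussianMGF Y c' P where
  integrable_exp_mul := hY.integrable_exp_mul
  mgf_le t := (hY.mgf_le t).trans (Real.exp_le_exp.2 (by gcongr))

lemma integrable_exp_mul_sum {Y : ℕ → Ω → ℝ} {c : ℝ≥0} (hind : iIndepFun Y P)
    (hY : ∀ i, HasSubgaussianMGF (Y i) c P) (l : ℝ) (m : ℕ) :
    Integrable (fun ω => Real.exp (l * ∑ s ∈ Finset.range m, Y s ω)) P :=
  (HasSubgaussianMGF.sum_of_iIndepFun hind (fun i _ => hY i)).integrable_exp_mul l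

variable [IsProbabilityMeasure P]

lemma one_le_mgf_of_integral_eq_zero {Y : Ω → ℝ} {c : ℝ≥0} (hY : HasSubgaussianMGF Y c P)
    (h0 : ∫ ω, Y ω ∂P = 0) (l : ℝ) : 1 ≤ ∫ ω, Real.exp (l * Y ω) ∂P := by
  calc (1 : ℝ) = ∫ ω, (l * Y ω + 1) ∂P := by
        rw [integral_add (hY.integrable.const_mul l) (integrable_const _), integral_const_mul, h0]
        simp
    _ ≤ _ := integral_mono ((hY.integrable.const_mul l).add (integrable_const _))
        (hY.integrable_exp_mul l) fun ω => Real.add_one_le_exp _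

/-- The exponential of a random walk with centered subgaussian steps is a submartingale. -/
lemma submartingale_exp_sum {Y : ℕ → Ω → ℝ} {c : ℝ≥0} (hm : ∀ i, StronglyMeasurable (Y i))
    (hind : iIndepFun Y P) (hY : ∀ i, HasSubgaussianMGF (Y i) c P)
    (h0 : ∀ i, ∫ ω, Y i ω ∂P = 0) (l : ℝ) :
    Submartingale (fun m ω => Real.exp (l * ∑ s ∈ Finset.range (m + 1), Y s ω))
      (Filtration.natural Y hm) P := by
  have hadp : StronglyAdapted (Filtration.natural Y hm)
      (fun m ω => Real.exp (l * ∑ s ∈ Finset.range (m + 1), Y s ω)) := by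
    intro m
    refine Real.continuous_exp.comp_stronglyMeasurable (StronglyMeasurable.const_mul ?_ l)
    refine Finset.stronglyMeasurable_fun_sum _ fun s hs => ?_
    exact (Filtration.stronglyAdapted_natural hm s).mono
      ((Filtration.natural Y hm).mono (Nat.lt_succ_iff.1 (Finset.mem_range.1 hs)))
  refine submartingale_nat hadp (fun m => integrable_exp_mul_sum hind hY l (m + 1)) fun m => ?_
  have hsplit : (fun ω => Real.exp (l * ∑ s ∈ Finset.range (m + 1 + 1), Y s ω)) =
      (fun ω => Real.exp (l * ∑ s ∈ Finset.range (m + 1), Y s ω)) *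
        fun ω => Real.exp (l * Y (m + 1) ω) := by
    ext ω
    rw [Finset.sum_range_succ, mul_add, Real.exp_add, Pi.mul_apply]
  have hpull := condExp_mul_of_stronglyMeasurable_left (μ := P) (hadp m)
    (g := fun ω => Real.exp (l * Y (m + 1) ω))
    (by rw [← hsplit]; exact integrable_exp_mul_sum hind hY l (m + 1 + 1))
    ((hY (m + 1)).integrable_exp_mul l)
  have hconst := condExp_indep_eq (μ := P) (f := fun ω => Real.exp (l * Y (m + 1) ω))
    (hm (m + 1)).measurable.comap_le ((Filtration.natural Y hm).le m)
    (Real.continuous_exp.comp_stronglyMeasurable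
      ((comap_measurable (Y (m + 1))).stronglyMeasurable.const_mul l))
    (hind.indep_comap_natural_of_lt hm (Nat.lt_succ_self m))
  rw [hsplit]
  filter_upwards [hpull, hconst] with ω h1 h2
  rw [h1, Pi.mul_apply, h2]
  exact le_mul_of_one_le_right (Real.exp_pos _).le
    (one_le_mgf_of_integral_eq_zero (hY (m + 1)) (h0 (m + 1)) l)

/-- Doob's maximal inequality for the exponential of a subgaussian random walk. -/
lemma measure_exists_le_sum_le_exp {Y : ℕ → Ω → ℝ} {c : ℝ≥0} (hm : ∀ i, StronglyMeasurable (Y i))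
    (hind : iIndepFun Y P) (hY : ∀ i, HasSubgaussianMGF (Y i) c P)
    (h0 : ∀ i, ∫ ω, Y i ω ∂P = 0) {l x : ℝ} (hl : 0 ≤ l) (N : ℕ) :
    P {ω | ∃ k, 1 ≤ k ∧ k ≤ N ∧ x ≤ ∑ s ∈ Finset.range k, Y s ω} ≤
      ENNReal.ofReal (Real.exp (-(l * x) + N * c * l ^ 2 / 2)) := by
  rcases N with _ | M
  · have : {ω | ∃ k, 1 ≤ k ∧ k ≤ 0 ∧ x ≤ ∑ s ∈ Finset.range k, Y s ω} = ∅ := by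
      ext ω
      simp only [Set.mem_ofPred_eq, Set.mem_empty_iff_false, iff_false]
      rintro ⟨k, h1, h2, -⟩
      omega
    rw [this, measure_empty]
    exact zero_le
  -- The natural filtration at time `m` already knows `Y m`, hence sums of `m + 1` terms and the
  -- split `N = M + 1`.
  set f : ℕ → Ω → ℝ := fun m ω => Real.exp (l * ∑ s ∈ Finset.range (m + 1), Y s ω) with hf
  have hmax := maximal_ineq (submartingale_exp_sum hm hind hY h0 l)
    (fun m ω => (Real.exp_pos _).le) (ε := ⟨Real.exp (l * x), (Real.exp_pos _).le⟩) M
  have hsub : {ω | ∃ k, 1 ≤ k ∧ k ≤ M + 1 ∧ x ≤ ∑ s ∈ Finset.range k, Y s ω} ⊆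
      {ω | Real.exp (l * x) ≤
        (Finset.range (M + 1)).sup' Finset.nonempty_range_add_one fun k => f k ω} := by
    rintro ω ⟨k, h1, h2, h3⟩
    obtain ⟨k, rfl⟩ := Nat.exists_eq_add_of_le' h1
    refine le_trans ?_ (Finset.le_sup' (fun k => f k ω) (Finset.mem_range.2 (by omega : k < M + 1)))
    exact Real.exp_le_exp.2 (mul_le_mul_of_nonneg_left h3 hl)
  have hmgf : ∫ ω, f M ω ∂P ≤ Real.exp ((M + 1 : ℕ) * c * l ^ 2 / 2) := by
    have := (HasSubgaussianMGF.sum_of_iIndepFun hind (s := Finset.range (M + 1))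
      (fun i _ => hY i)).mgf_le l
    simpa [mgf, hf] using this
  have hint : Integrable (f M) P := integrable_exp_mul_sum hind hY l (M + 1)
  have hle := hmax.trans (ENNReal.ofReal_le_ofReal
    ((setIntegral_le_integral hint (ae_of_all _ fun ω => (Real.exp_pos _).le)).trans hmgf))
  refine (measure_mono hsub).trans ?_
  have hpos : (0 : ℝ) < Real.exp (l * x) := Real.exp_pos _
  have hcoe : ENNReal.ofNNReal ⟨Real.exp (l * x), hpos.le⟩ = ENNReal.ofReal (Real.exp (l * x)) :=
    (ENNReal.ofReal_eq_coe_nnreal hpos.le).symm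
  rw [hcoe, mul_comm, ← ENNReal.le_div_iff_mul_le
    (Or.inl (by simpa using Real.exp_pos _)) (Or.inl ENNReal.ofReal_ne_top),
    ← ENNReal.ofReal_div_of_pos hpos, ← Real.exp_sub] at hle
  refine hle.trans (ENNReal.ofReal_le_ofReal (Real.exp_le_exp.2 ?_))
  linarith

/-- The maximal inequality of `measure_exists_le_sum_le_exp` with optimized exponent. -/
lemma measure_exists_le_sum_le {Y : ℕ → Ω → ℝ} {c : ℝ≥0} (hm : ∀ i, StronglyMeasurable (Y i))
    (hind : iIndepFun Y P) (hY : ∀ i, HasSubgaussianMGF (Y i) c P)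
    (h0 : ∀ i, ∫ ω, Y i ω ∂P = 0) {x : ℝ} (hx : 0 ≤ x) (hc : 0 < c) {N : ℕ} (hN : 0 < N) :
    P {ω | ∃ k, 1 ≤ k ∧ k ≤ N ∧ x ≤ ∑ s ∈ Finset.range k, Y s ω} ≤
      ENNReal.ofReal (Real.exp (-(x ^ 2 / (2 * N * c)))) := by
  have hc' : (0 : ℝ) < c := hc
  have hN' : (0 : ℝ) < N := by exact_mod_cast hN
  -- This `l` minimizes `-(l * x) + N * c * l ^ 2 / 2`.
  refine (measure_exists_le_sum_le_exp hm hind hY h0 (l := x / (N * c)) (by positivity) N).trans ?_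
  refine ENNReal.ofReal_le_ofReal (Real.exp_le_exp.2 (le_of_eq ?_))
  field_simp
  ring

end Maximal

/-! ### Iterated logarithm bound by peeling over geometric blocks. -/

section IteratedLog

lemma one_lt_one_add_sqrt_sq {ε : ℝ} (hε : 0 < ε) : 1 < (1 + √ε) ^ 2 := by
  have := Real.sqrt_pos.2 hε
  nlinarith

/-- The threshold used on the `k`-th block `[(1 + ε) ^ k, (1 + ε) ^ (k + 1)]`. -/
noncomputable def blockThreshold (ε d : ℝ) (k : ℕ) : ℝ :=
  (1 + √ε) * √((1 + ε) ^ (k + 1) / 2 * Real.log ((k + 1) * Real.log (1 + ε) / d))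

/-- From the start of block `k` on, `log ((1 + ε) * t)` is at least `(k + 1) * log (1 + ε)`, so a
walk that exceeds `t * width` also exceeds a threshold constant on the block. -/
lemma blockThreshold_le_mul_width {ε d : ℝ} (hε : 0 < ε) (hd : 0 < d) {k t : ℕ} (ht : 1 ≤ t)
    (hkt : (1 + ε) ^ k ≤ (t : ℝ)) (hdε : d ≤ Real.log (1 + ε)) :
    blockThreshold ε d k ≤ t * width ε t d := by
  have ht' : (0 : ℝ) < t := by exact_mod_cast ht
  have hlog : 0 < Real.log (1 + ε) := Real.log_pos (by linarith)
  have key : (k + 1) * Real.log (1 + ε) ≤ Real.log ((1 + ε) * t) := by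
    have : Real.log ((1 + ε) ^ (k + 1)) ≤ Real.log ((1 + ε) * t) := by
      apply Real.log_le_log (by positivity)
      rw [pow_succ']
      gcongr
    rw [Real.log_pow] at this
    exact_mod_cast this
  have hl0 : 0 ≤ Real.log ((k + 1) * Real.log (1 + ε) / d) := by
    apply Real.log_nonneg
    rw [one_le_div hd]
    have : (0 : ℝ) ≤ k := k.cast_nonneg
    nlinarith
  have hl : Real.log ((k + 1) * Real.log (1 + ε) / d) ≤
      Real.log (Real.log ((1 + ε) * t) / d) :=
    Real.log_le_log (by positivity) (by gcongr)
  have hw : t * width ε t d =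
      (1 + √ε) * √((1 + ε) * t / 2 * Real.log (Real.log ((1 + ε) * t) / d)) := by
    have : (1 + ε) * t / 2 * Real.log (Real.log ((1 + ε) * t) / d) =
        (t : ℝ) ^ 2 * ((1 + ε) / (2 * t) * Real.log (Real.log ((1 + ε) * t) / d)) := by
      field_simp
    rw [this, Real.sqrt_mul (by positivity), Real.sqrt_sq ht'.le, width]
    ring
  rw [hw, blockThreshold, pow_succ']
  gcongr

/-- The factor `1 + √ε` in the width raises the tail to the power `(1 + √ε) ^ 2 > 1`, which makes
the bounds summable over blocks. The factor `1 + ε` under the root absorbs the length of a block. -/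
lemma exp_neg_blockThreshold_le {ε d : ℝ} (hε : 0 < ε) (hd : 0 < d)
    (hdε : d ≤ Real.log (1 + ε)) {k N : ℕ} (hN : 0 < N) (hNk : (N : ℝ) ≤ (1 + ε) ^ (k + 1)) :
    Real.exp (-(blockThreshold ε d k ^ 2 / (2 * N * (1 / 4 : ℝ)))) ≤
      d / Real.log (1 + ε) * (1 / (((k : ℝ) + 1) ^ ((1 + √ε) ^ 2))) := by
  have hN' : (0 : ℝ) < N := by exact_mod_cast hN
  have hlog : 0 < Real.log (1 + ε) := Real.log_pos (by linarith)
  have hk : (0 : ℝ) < (k : ℝ) + 1 := by positivity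
  have hs := one_lt_one_add_sqrt_sq hε
  have hl0 : 0 ≤ Real.log ((k + 1) * Real.log (1 + ε) / d) := by
    apply Real.log_nonneg
    rw [one_le_div hd]
    have : (0 : ℝ) ≤ k := k.cast_nonneg
    nlinarith
  set ℓ := Real.log ((k + 1) * Real.log (1 + ε) / d) with hℓ
  have hsq : blockThreshold ε d k ^ 2 / (2 * N * (1 / 4 : ℝ)) =
      (1 + √ε) ^ 2 * ((1 + ε) ^ (k + 1) / N) * ℓ := by
    rw [blockThreshold, mul_pow, Real.sq_sqrt (by positivity)]
    field_simp
    ring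
  have h1 : 1 ≤ (1 + ε) ^ (k + 1) / (N : ℝ) := (one_le_div hN').2 hNk
  have hge : (1 + √ε) ^ 2 * ℓ ≤ (1 + √ε) ^ 2 * ((1 + ε) ^ (k + 1) / N) * ℓ := by
    apply mul_le_mul_of_nonneg_right _ hl0
    nlinarith
  rw [hsq]
  calc Real.exp (-((1 + √ε) ^ 2 * ((1 + ε) ^ (k + 1) / N) * ℓ))
      ≤ Real.exp (-((1 + √ε) ^ 2 * ℓ)) := Real.exp_le_exp.2 (neg_le_neg hge)
    _ = (d / Real.log (1 + ε) / (k + 1)) ^ ((1 + √ε) ^ 2) := by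
        rw [Real.rpow_def_of_pos (by positivity)]
        congr 1
        have : d / Real.log (1 + ε) / (k + 1) = ((k + 1) * Real.log (1 + ε) / d)⁻¹ := by
          field_simp
        rw [this, Real.log_inv]
        ring
    _ = (d / Real.log (1 + ε)) ^ ((1 + √ε) ^ 2) * (1 / (((k : ℝ) + 1) ^ ((1 + √ε) ^ 2))) := by
        rw [Real.div_rpow (by positivity) hk.le]
        ring
    _ ≤ _ := by
        -- The base `d / log (1 + ε)` is at most `1`, so its exponent can be lowered to `1`, leaving
        -- a bound linear in `d`.
        gcongr
        exact (Real.rpow_le_rpow_of_exponent_ge (by positivity) ((div_le_one hlog).2 hdε)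
          hs.le).trans_eq (Real.rpow_one _)

lemma summable_block {ε : ℝ} (hε : 0 < ε) :
    Summable fun k : ℕ => 1 / (((k : ℝ) + 1) ^ ((1 + √ε) ^ 2)) := by
  have := (summable_nat_add_iff 1).2 (Real.summable_one_div_nat_rpow.2 (one_lt_one_add_sqrt_sq hε))
  simpa using this

lemma exists_block {ε : ℝ} (hε : 0 < ε) {t : ℕ} (ht : 1 ≤ t) :
    ∃ k : ℕ, (1 + ε) ^ k ≤ (t : ℝ) ∧ (t : ℝ) < (1 + ε) ^ (k + 1) :=
  exists_nat_pow_near (by exact_mod_cast ht) (by linarith)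

/-- A finite-sample law of the iterated logarithm for subgaussian random walks. -/
lemma measure_exists_width_lt_sum_le {Ω : Type*} [MeasurableSpace Ω] {P : Measure Ω}
    [IsProbabilityMeasure P] {Y : ℕ → Ω → ℝ} (hm : ∀ i, StronglyMeasurable (Y i))
    (hind : iIndepFun Y P) (hY : ∀ i, HasSubgaussianMGF (Y i) (1 / 4) P)
    (h0 : ∀ i, ∫ ω, Y i ω ∂P = 0) {ε d : ℝ} (hε : 0 < ε) (hd : 0 < d)
    (hdε : d ≤ Real.log (1 + ε)) :
    P {ω | ∃ t : ℕ, 1 ≤ t ∧ t * width ε t d < ∑ s ∈ Finset.range t, Y s ω} ≤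
      ENNReal.ofReal (d / Real.log (1 + ε) *
        ∑' k : ℕ, 1 / (((k : ℝ) + 1) ^ ((1 + √ε) ^ 2))) := by
  have hlog : 0 < Real.log (1 + ε) := Real.log_pos (by linarith)
  have hsub : {ω | ∃ t : ℕ, 1 ≤ t ∧ t * width ε t d < ∑ s ∈ Finset.range t, Y s ω} ⊆
      ⋃ k : ℕ, {ω | ∃ t, 1 ≤ t ∧ t ≤ ⌊(1 + ε) ^ (k + 1)⌋₊ ∧
        blockThreshold ε d k ≤ ∑ s ∈ Finset.range t, Y s ω} := by
    rintro ω ⟨t, ht, h⟩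
    obtain ⟨k, h1, h2⟩ := exists_block hε ht
    exact Set.mem_iUnion.2 ⟨k, t, ht, Nat.le_floor h2.le,
      (blockThreshold_le_mul_width hε hd ht h1 hdε).trans h.le⟩
  refine (measure_mono hsub).trans ((measure_iUnion_le _).trans ?_)
  rw [← tsum_mul_left, ENNReal.ofReal_tsum_of_nonneg (fun k => by positivity)
    ((summable_block hε).mul_left _)]
  refine ENNReal.tsum_le_tsum fun k => ?_
  have hpos : 0 < ⌊(1 + ε) ^ (k + 1)⌋₊ :=
    Nat.floor_pos.2 (one_le_pow₀ (by linarith))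
  refine (measure_exists_le_sum_le hm hind hY h0 (by unfold blockThreshold; positivity)
    (by norm_num) hpos).trans (ENNReal.ofReal_le_ofReal ?_)
  have := exp_neg_blockThreshold_le hε hd hdε hpos (Nat.floor_le (by positivity))
  simpa using this

end IteratedLog


/-! ### Pathwise analysis of a run. -/

section Run

variable {n : ℕ}

lemma worst_le (f : Fin n → ℝ) {G : Finset (Fin n)} {i : Fin n} (hi : i ∈ G) : worst f G ≤ f i :=
  ciInf_le (Set.finite_range fun j : G => f j).bddBelow (⟨i, hi⟩ : G)

lemma le_worst {f : Fin n → ℝ} {G : Finset (Fin n)} (hG : G.Nonempty) {b : ℝ}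
    (h : ∀ i ∈ G, b ≤ f i) : b ≤ worst f G :=
  have : Nonempty G := hG.to_subtype
  le_ciInf fun i => h i i.2

lemma worst_mono {f g : Fin n → ℝ} {G : Finset (Fin n)} (hG : G.Nonempty)
    (h : ∀ i, f i ≤ g i) : worst f G ≤ worst g G :=
  le_worst hG fun i hi => (worst_le f hi).trans (h i)

lemma simpleRegret_le {𝒢 : Finset (Finset (Fin n))} (hne : 𝒢.Nonempty) {μ : Fin n → ℝ}
    {H : Finset (Fin n)} {b : ℝ} (h : ∀ K ∈ 𝒢, worst μ K - worst μ H ≤ b) :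
    simpleRegret 𝒢 μ H ≤ b := by
  have : Nonempty 𝒢 := hne.to_subtype
  have : ⨆ K : 𝒢, worst μ K ≤ b + worst μ H := ciSup_le fun K => by linarith [h K K.2]
  unfold simpleRegret
  linarith

lemma simpleRegret_le_one {𝒢 : Finset (Finset (Fin n))} (hne : 𝒢.Nonempty)
    (hG : ∀ G ∈ 𝒢, G.Nonempty) {μ : Fin n → ℝ} (hμ : ∀ j, μ j ∈ Set.Icc (0 : ℝ) 1)
    {H : Finset (Fin n)} (hH : H ∈ 𝒢) : simpleRegret 𝒢 μ H ≤ 1 := by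
  refine simpleRegret_le hne fun K hK => ?_
  obtain ⟨i, hi⟩ := hG K hK
  have h1 := (worst_le μ hi).trans (hμ i).2
  have h2 := le_worst (hG H hH) fun i _ => (hμ i).1
  linarith

lemma exists_le_mul_pulls (a : ℕ → Fin n) (T : ℕ) (hn : 0 < n) : ∃ j, T ≤ n * pulls a T j := by
  have : Nonempty (Fin n) := ⟨⟨0, hn⟩⟩
  by_contra! h
  have hsum : ∑ j, pulls a T j = T := by
    simpa [pulls] using (Finset.card_eq_sum_card_fiberwise (s := Finset.Icc 1 T)
      (t := Finset.univ) (f := a) (fun _ _ => by simp)).symm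
  have : ∑ j : Fin n, n * pulls a T j < ∑ _j : Fin n, T :=
    Finset.sum_lt_sum_of_nonempty Finset.univ_nonempty fun j _ => h j
  rw [← Finset.mul_sum, hsum] at this
  simp at this

/-- The witness is the last round up to `T` in which `j` is pulled. -/
lemma exists_pulls_pred (a : ℕ → Fin n) (T : ℕ) (j : Fin n) (h : 0 < pulls a T j) :
    ∃ t ∈ Finset.Icc 1 T, a t = j ∧ pulls a (t - 1) j + 1 = pulls a T j := by
  induction T with
  | zero => simp [pulls] at h
  | succ T ih =>
    have hstep : pulls a (T + 1) j = pulls a T j + if a (T + 1) = j then 1 else 0 := by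
      unfold pulls
      rw [← Finset.insert_Icc_right_eq_Icc_add_one (by omega : 1 ≤ T + 1), Finset.filter_insert]
      split_ifs with hj
      · rw [Finset.card_insert_of_notMem (by simp)]
      · simp
    by_cases hj : a (T + 1) = j
    · exact ⟨T + 1, by simp, hj, by simp [hstep, hj]⟩
    · rw [if_neg hj, add_zero] at hstep
      obtain ⟨t, ht, h1, h2⟩ := ih (hstep ▸ h)
      exact ⟨t, Finset.Icc_subset_Icc_right (by omega) ht, h1, h2.trans hstep.symm⟩

/-- All empirical means are within the confidence width of the true means. -/
def Concentrated (ε d : ℝ) (x : Fin n → ℕ → ℝ) (μ : Fin n → ℝ) : Prop :=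
  ∀ j k, 1 ≤ k → |empMean x j k - μ j| ≤ width ε k d

variable {𝒢 : Finset (Finset (Fin n))} {ε δ : ℝ} {x : Fin n → ℕ → ℝ} {μ : Fin n → ℝ}
  {G : ℕ → Finset (Fin n)} {a : ℕ → Fin n}

lemma Concentrated.le_UCB (hc : Concentrated ε (δ / n) x μ) (hμ : ∀ j, μ j ∈ Set.Icc (0 : ℝ) 1)
    (t : ℕ) (j : Fin n) : μ j ≤ UCB ε δ x a t j := by
  unfold UCB
  split_ifs with h
  · exact (hμ j).2
  · linarith [(abs_le.1 (hc j _ (Nat.one_le_iff_ne_zero.2 h))).1]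

lemma Concentrated.LCB_le (hc : Concentrated ε (δ / n) x μ) (hμ : ∀ j, μ j ∈ Set.Icc (0 : ℝ) 1)
    (t : ℕ) (j : Fin n) : LCB ε δ x a t j ≤ μ j := by
  unfold LCB
  split_ifs with h
  · exact (hμ j).1
  · linarith [(abs_le.1 (hc j _ (Nat.one_le_iff_ne_zero.2 h))).2]

/-- On the concentration event the regret of the output is at most the width of the confidence
interval of every arm pulled so far. -/
lemma simpleRegret_le_UCB_sub_LCB (hne : 𝒢.Nonempty) (hG : ∀ G ∈ 𝒢, G.Nonempty)
    (hμ : ∀ j, μ j ∈ Set.Icc (0 : ℝ) 1) (hc : Concentrated ε (δ / n) x μ)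
    (hrun : IsStableOptRun 𝒢 ε δ x G a) {T : ℕ} {H : Finset (Fin n)}
    (hH : IsOutput ε δ x G a T H) {t : ℕ} (ht : t ∈ Finset.Icc 1 T) :
    simpleRegret 𝒢 μ H ≤ UCB ε δ x a (t - 1) (a t) - LCB ε δ x a (t - 1) (a t) := by
  obtain ⟨r, hr, rfl, hmax⟩ := hH
  have ht1 := (Finset.mem_Icc.1 ht).1
  have hr1 := (Finset.mem_Icc.1 hr).1
  refine simpleRegret_le hne fun K hK => ?_
  have hup : worst μ K ≤ UCB ε δ x a (t - 1) (a t) :=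
    ((worst_mono (hG K hK) (hc.le_UCB hμ (t - 1))).trans (hrun.group_argmax t ht1 K hK)).trans
      (worst_le _ (hrun.arm_mem t ht1))
  have hlow : LCB ε δ x a (t - 1) (a t) ≤ worst μ (G r) :=
    ((le_worst (hG _ (hrun.group_mem t ht1)) (hrun.arm_argmin t ht1)).trans (hmax t ht)).trans
      (worst_mono (hG _ (hrun.group_mem r hr1)) (hc.LCB_le hμ (r - 1)))
  linarith

/-- Here `k` counts the pulls of a pigeonhole arm just before its last pull. With `m ≥ 2` pulls in
total, `m ≤ 2 * (m - 1)`, which costs the factor `2` in `T ≤ 2 * n * k`. -/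
lemma exists_simpleRegret_le_width (hn : 0 < n) (hne : 𝒢.Nonempty) (hG : ∀ G ∈ 𝒢, G.Nonempty)
    (hμ : ∀ j, μ j ∈ Set.Icc (0 : ℝ) 1) (hc : Concentrated ε (δ / n) x μ)
    (hrun : IsStableOptRun 𝒢 ε δ x G a) {T : ℕ} (hT : 2 * n ≤ T) {H : Finset (Fin n)}
    (hH : IsOutput ε δ x G a T H) :
    ∃ k : ℕ, 1 ≤ k ∧ k ≤ T ∧ T ≤ 2 * n * k ∧ simpleRegret 𝒢 μ H ≤ 2 * width ε k (δ / n) := by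
  obtain ⟨j, hj⟩ := exists_le_mul_pulls a T hn
  -- A pull must remain before the last one, so that the confidence bounds are not the default
  -- values `1` and `0`.
  have h2 : 2 ≤ pulls a T j := by
    by_contra! h
    have : n * pulls a T j ≤ n * 1 := Nat.mul_le_mul_left n (by omega)
    omega
  obtain ⟨t, ht, rfl, hk⟩ := exists_pulls_pred a T j (by omega)
  have hle : pulls a T (a t) ≤ T := by
    simpa [pulls] using Finset.card_filter_le (Finset.Icc 1 T) (fun s => a s = a t)
  refine ⟨pulls a (t - 1) (a t), by omega, by omega, ?_, ?_⟩
  · calc T ≤ n * pulls a T (a t) := hj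
      _ ≤ n * (2 * pulls a (t - 1) (a t)) := Nat.mul_le_mul_left n (by omega)
      _ = _ := by ring
  · refine (simpleRegret_le_UCB_sub_LCB hne hG hμ hc hrun hH ht).trans (le_of_eq ?_)
    have h0 : pulls a (t - 1) (a t) ≠ 0 := by omega
    rw [UCB, LCB, if_neg h0, if_neg h0]
    ring

end Run

/-! ### From the confidence width to the stated rate. -/

section Bound

lemma one_le_sqrt_log {n : ℕ} (hn : 0 < n) {δ : ℝ}
    (hδ : δ ∈ Set.Ioo (0 : ℝ) (Real.log 2 / Real.exp 1)) : 1 ≤ √(Real.log (n / δ)) := by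
  have hn' : (1 : ℝ) ≤ n := by exact_mod_cast hn
  have hlog2 := Real.log_two_lt_d9
  rw [Real.one_le_sqrt, Real.le_log_iff_exp_le (div_pos (by linarith) hδ.1), le_div_iff₀ hδ.1]
  have := (lt_div_iff₀ (Real.exp_pos 1)).1 hδ.2
  linarith

/-- The term `log (log T)` is negative at `T = 2`; this bound and `one_le_sqrt_log` keep the sum in
the final rate at least `1 / 2`. -/
lemma neg_half_le_log_log {T : ℕ} (hT : 2 ≤ T) : -(1 / 2) ≤ Real.log (Real.log T) := by
  have hlog2 := Real.log_two_gt_d9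
  have hT' : Real.log 2 ≤ Real.log T := Real.log_le_log (by norm_num) (by exact_mod_cast hT)
  rw [Real.le_log_iff_exp_le (by linarith)]
  have h1 : Real.exp (-(1 / 2)) ≤ (1 + 1 / 2 + (1 / 2) ^ 2 / 2)⁻¹ := by
    rw [Real.exp_neg]
    exact inv_anti₀ (by norm_num) (Real.quadratic_le_exp_of_nonneg (by norm_num))
  norm_num at h1
  linarith

lemma sqrt_two_mul_sq_add_le {s b : ℝ} (hs : 1 ≤ s) (hb : -(1 / 2) ≤ b) :
    √(2 * s ^ 2 + b) ≤ 3 * (s + b) := by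
  refine Real.sqrt_le_iff.2 ⟨by linarith, ?_⟩
  rcases le_total 0 b with h | h
  · nlinarith [mul_nonneg (sub_nonneg.2 hs) h]
  · nlinarith [mul_nonneg (sub_nonneg.2 hs) (by linarith : 0 ≤ b + 1 / 2)]

lemma width_le {ε δ : ℝ} (hε : ε ∈ Set.Ioo (0 : ℝ) 1)
    (hδ : δ ∈ Set.Ioo (0 : ℝ) (Real.log 2 / Real.exp 1)) {n T k : ℕ} (hn : 0 < n) (hT : 2 ≤ T)
    (hk : 1 ≤ k) (hkT : k ≤ T) (hTk : T ≤ 2 * n * k) :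
    width ε k (δ / n) ≤
      2 * (√2 * (√(n / T) * (3 * (√(Real.log (n / δ)) + Real.log (Real.log T))))) := by
  obtain ⟨hε0, hε1⟩ := hε
  have hδ0 := hδ.1
  have hn' : (1 : ℝ) ≤ n := by exact_mod_cast hn
  have hT' : (2 : ℝ) ≤ T := by exact_mod_cast hT
  have hk' : (1 : ℝ) ≤ k := by exact_mod_cast hk
  have hkT' : (k : ℝ) ≤ T := by exact_mod_cast hkT
  have hTk' : (T : ℝ) ≤ 2 * n * k := by exact_mod_cast hTk
  have hs := one_le_sqrt_log hn hδ
  have hb := neg_half_le_log_log hT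
  set s := √(Real.log (n / δ)) with hsdef
  have hs2 : Real.log (n / δ) = s ^ 2 :=
    (Real.sq_sqrt (zero_le_one.trans (Real.one_le_sqrt.1 hs))).symm
  have hlogT : 0 < Real.log T := Real.log_pos (by linarith)
  have hlogk : 0 < Real.log ((1 + ε) * k) := Real.log_pos (by nlinarith)
  have hlog : Real.log (Real.log ((1 + ε) * k) / (δ / n)) ≤ 2 * s ^ 2 + Real.log (Real.log T) := by
    -- Since `1 + ε ≤ 2 ≤ T` and `k ≤ T`, the argument is at most `T * T`.
    have h1 : Real.log ((1 + ε) * k) ≤ 2 * Real.log T := by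
      rw [two_mul, ← Real.log_mul (by positivity) (by positivity)]
      exact Real.log_le_log (by positivity) (by nlinarith)
    have h2 : Real.log ((1 + ε) * k) / (δ / n) ≤ 2 * Real.log T * (n / δ) := by
      rw [div_div_eq_mul_div, mul_div_assoc]
      gcongr
    refine (Real.log_le_log (by positivity) h2).trans ?_
    rw [Real.log_mul (by positivity) (by positivity), Real.log_mul (by norm_num) hlogT.ne', hs2]
    -- The leftover `log 2` is absorbed by the second `s ^ 2`, as `s ≥ 1`.
    nlinarith [Real.log_two_lt_d9]
  have hfrac : (1 + ε) / (2 * k) ≤ 2 * (n / T) := by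
    rw [← mul_div_assoc, div_le_div_iff₀ (by positivity) (by positivity)]
    nlinarith
  have hsε : √ε ≤ 1 := Real.sqrt_le_one.2 hε1.le
  have hpos : 0 ≤ 2 * s ^ 2 + Real.log (Real.log T) := by nlinarith
  unfold width
  calc (1 + √ε) * √((1 + ε) / (2 * k) * Real.log (Real.log ((1 + ε) * k) / (δ / n)))
      ≤ 2 * √(2 * (n / T) * (2 * s ^ 2 + Real.log (Real.log T))) := by
        refine mul_le_mul (by linarith) (Real.sqrt_le_sqrt ?_) (by positivity) (by norm_num)
        exact (mul_le_mul_of_nonneg_left hlog (by positivity)).trans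
          (mul_le_mul_of_nonneg_right hfrac hpos)
    _ = 2 * (√2 * (√(n / T) * √(2 * s ^ 2 + Real.log (Real.log T)))) := by
        rw [mul_assoc, Real.sqrt_mul (by norm_num), Real.sqrt_mul (by positivity)]
    _ ≤ _ := by
        gcongr
        exact sqrt_two_mul_sq_add_le hs hb

/-- The regret bound on the concentration event. -/
lemma simpleRegret_le_of_concentrated {ε δ : ℝ} (hε : ε ∈ Set.Ioo (0 : ℝ) 1)
    (hδ : δ ∈ Set.Ioo (0 : ℝ) (Real.log 2 / Real.exp 1)) {n : ℕ} (hn : 0 < n)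
    {𝒢 : Finset (Finset (Fin n))} (hne : 𝒢.Nonempty) (hG : ∀ G ∈ 𝒢, G.Nonempty)
    {x : Fin n → ℕ → ℝ} {μ : Fin n → ℝ} (hμ : ∀ j, μ j ∈ Set.Icc (0 : ℝ) 1)
    (hc : Concentrated ε (δ / n) x μ) {G : ℕ → Finset (Fin n)} {a : ℕ → Fin n}
    (hrun : IsStableOptRun 𝒢 ε δ x G a) {T : ℕ} (hT : 2 ≤ T) {H : Finset (Fin n)}
    (hH : IsOutput ε δ x G a T H) :
    simpleRegret 𝒢 μ H ≤
      12 * √2 * (√(n / T) * (√(Real.log (n / δ)) + Real.log (Real.log T))) := by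
  rcases le_or_gt (2 * n) T with h | h
  · obtain ⟨k, h1, h2, h3, h4⟩ := exists_simpleRegret_le_width hn hne hG hμ hc hrun h hH
    refine h4.trans ?_
    linarith [width_le hε hδ hn hT h1 h2 h3]
  -- For `T < 2 * n` the trivial bound `1` on the regret is already below the right-hand side.
  · obtain ⟨t, ht, rfl, -⟩ := hH
    refine (simpleRegret_le_one hne hG hμ (hrun.group_mem t (Finset.mem_Icc.1 ht).1)).trans ?_
    have hn' : (0 : ℝ) < n := by exact_mod_cast hn
    have hT' : (0 : ℝ) < T := by exact_mod_cast (by omega : 0 < T)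
    have h' : (T : ℝ) ≤ 2 * n := by exact_mod_cast h.le
    have hs := one_le_sqrt_log hn hδ
    have hb := neg_half_le_log_log hT
    have hone : 1 ≤ √2 * √(n / T) := by
      rw [← Real.sqrt_mul (by norm_num), Real.one_le_sqrt, ← mul_div_assoc, one_le_div hT']
      exact h'
    nlinarith

end Bound


/-! ### Failure probability and assembly. -/

/-- The concentration event fails with probability at most a constant times `δ`. -/
lemma measure_not_concentrated_le {ε δ : ℝ} (hε : 0 < ε) (hδ : 0 < δ)
    (hδε : δ ≤ Real.log (1 + ε)) {n : ℕ} (hn : 0 < n) {Ω : Type*} [MeasurableSpace Ω]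
    {P : Measure Ω} [IsProbabilityMeasure P] {X : Fin n → ℕ → Ω → ℝ} {μ : Fin n → ℝ}
    (hX : ∀ j s, Measurable (X j s)) (hind : ∀ j, iIndepFun (X j) P)
    (hint : ∀ j s, ∫ ω, (X j s ω - μ j) ∂P = 0)
    (hsub : ∀ j s, HasSubgaussianMGF (fun ω => X j s ω - μ j) (1 / 4) P) :
    P {ω | ¬ Concentrated ε (δ / n) (fun j s => X j s ω) μ} ≤
      ENNReal.ofReal (2 * (δ / Real.log (1 + ε) *
        ∑' k : ℕ, 1 / (((k : ℝ) + 1) ^ ((1 + √ε) ^ 2)))) := by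
  have hn' : (1 : ℝ) ≤ n := by exact_mod_cast hn
  have hd : 0 < δ / n := by positivity
  have hdε : δ / n ≤ Real.log (1 + ε) := (div_le_self hδ.le hn').trans hδε
  have hlog : 0 < Real.log (1 + ε) := Real.log_pos (by linarith)
  set S := ∑' k : ℕ, 1 / (((k : ℝ) + 1) ^ ((1 + √ε) ^ 2))
  have hS0 : 0 ≤ S := tsum_nonneg fun k => by positivity
  have hup (j : Fin n) := measure_exists_width_lt_sum_le (P := P) (Y := fun s ω => X j s ω - μ j)
    (fun s => ((hX j s).sub_const _).stronglyMeasurable)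
    ((hind j).comp (fun _ y => y - μ j) fun _ => measurable_id.sub_const _)
    (hsub j) (hint j) hε hd hdε
  have hdown (j : Fin n) := measure_exists_width_lt_sum_le (P := P)
    (Y := fun s ω => -(X j s ω - μ j))
    (fun s => ((hX j s).sub_const _).neg.stronglyMeasurable)
    ((hind j).comp (fun _ y => -(y - μ j)) fun _ => (measurable_id.sub_const _).neg)
    (fun s => (hsub j s).neg) (fun s => by rw [integral_neg, hint j s, neg_zero]) hε hd hdε
  have hcover : {ω | ¬ Concentrated ε (δ / n) (fun j s => X j s ω) μ} ⊆
      ⋃ j : Fin n,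
        ({ω | ∃ t : ℕ, 1 ≤ t ∧ t * width ε t (δ / n) < ∑ s ∈ Finset.range t, (X j s ω - μ j)} ∪
        {ω | ∃ t : ℕ, 1 ≤ t ∧
          t * width ε t (δ / n) < ∑ s ∈ Finset.range t, -(X j s ω - μ j)}) := by
    intro ω hω
    simp only [Concentrated, Set.mem_ofPred_eq, not_forall, not_le] at hω
    obtain ⟨j, k, hk, h⟩ := hω
    have hk' : (0 : ℝ) < k := by exact_mod_cast hk
    have hsum : ∑ s ∈ Finset.range k, (X j s ω - μ j) =
        k * (empMean (fun j s => X j s ω) j k - μ j) := by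
      rw [Finset.sum_sub_distrib, empMean, mul_sub, mul_div_cancel₀ _ hk'.ne']
      simp
    refine Set.mem_iUnion.2 ⟨j, ?_⟩
    rcases lt_abs.1 h with h | h
    · exact Or.inl ⟨k, hk, by rw [hsum]; gcongr⟩
    · exact Or.inr ⟨k, hk, by rw [Finset.sum_neg_distrib, hsum, ← mul_neg]; gcongr⟩
  calc P {ω | ¬ Concentrated ε (δ / n) (fun j s => X j s ω) μ}
      ≤ ∑ _j : Fin n, (ENNReal.ofReal (δ / n / Real.log (1 + ε) * S) +
          ENNReal.ofReal (δ / n / Real.log (1 + ε) * S)) :=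
        (measure_mono hcover).trans <| (measure_iUnion_fintype_le P _).trans <|
          Finset.sum_le_sum fun j _ =>
            (measure_union_le _ _).trans (add_le_add (hup j) (hdown j))
    _ = ENNReal.ofReal (2 * (δ / Real.log (1 + ε) * S)) := by
        rw [← ENNReal.ofReal_add (by positivity) (by positivity),
          ← ENNReal.ofReal_sum_of_nonneg fun _ _ => by positivity]
        congr 1
        simp only [Finset.sum_const, Finset.card_univ, Fintype.card_fin, nsmul_eq_mul]
        field_simp
        ring

end GroupedBandit

theorem mainTheorem2 (ε : ℝ) (hε : ε ∈ Set.Ioo (0 : ℝ) 1) :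
    ∃ C > (0 : ℝ), ∃ c > (0 : ℝ),
      ∀ (n : ℕ) (𝒢 : Finset (Finset (Fin n))), 𝒢.Nonempty → (∀ G ∈ 𝒢, G.Nonempty) →
      -- `D j` is the reward distribution of arm `j`, and `μ j` its mean
      ∀ (D : Fin n → Measure ℝ) [∀ j, IsProbabilityMeasure (D j)] (μ : Fin n → ℝ),
        (∀ j, μ j = ∫ y, y ∂(D j)) → (∀ j, μ j ∈ Set.Icc (0 : ℝ) 1) →
      ∀ R : ℝ≥0, R ≤ 1 / 2 → (∀ j, HasSubgaussianMGF (fun y => y - μ j) (R ^ 2) (D j)) →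
      -- the rewards `X j 0, X j 1, …` of each arm `j` are i.i.d. with distribution `D j`
      ∀ (Ω : Type*) [MeasurableSpace Ω] (P : Measure Ω) [IsProbabilityMeasure P]
        (X : Fin n → ℕ → Ω → ℝ),
        (∀ j s, Measurable (X j s)) → (∀ j s, P.map (X j s) = D j) →
        (∀ j, iIndepFun (X j) P) →
      ∀ δ ∈ Set.Ioo (0 : ℝ) (Real.log 2 / Real.exp 1),
        ∃ E : Set Ω, MeasurableSet E ∧ 1 - c * δ ≤ P.real E ∧
          ∀ ω ∈ E, ∀ (G : ℕ → Finset (Fin n)) (a : ℕ → Fin n),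
            GroupedBandit.IsStableOptRun 𝒢 ε δ (fun j s => X j s ω) G a →
            ∀ T : ℕ, 2 ≤ T → ∀ H : Finset (Fin n),
              GroupedBandit.IsOutput ε δ (fun j s => X j s ω) G a T H →
              GroupedBandit.simpleRegret 𝒢 μ H ≤
                C * (√(n / T) * (√(Real.log (n / δ)) + Real.log (Real.log T))) := by
  obtain ⟨hε0, hε1⟩ := hε
  have hlog : 0 < Real.log (1 + ε) := Real.log_pos (by linarith)
  set S := ∑' k : ℕ, 1 / (((k : ℝ) + 1) ^ ((1 + √ε) ^ 2))
  have hS0 : 0 ≤ S := tsum_nonneg fun k => by positivity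
  -- In `c`, the `2 * S` pays for the two tails and the `+ 1` makes `c * δ ≥ 1` when `δ > log (1 +
  -- ε)`; the empty event then suffices.
  refine ⟨12 * √2, by positivity, (2 * S + 1) / Real.log (1 + ε), by positivity, ?_⟩
  intro n 𝒢 hne hG D _ μ hμD hμ R hR hsubD Ω _ P _ X hX hXD hind δ hδ
  have hδ0 := hδ.1
  obtain ⟨G₀, hG₀⟩ := hne
  obtain ⟨i₀, -⟩ := hG G₀ hG₀
  have hn : 0 < n := i₀.pos
  rcases le_or_gt δ (Real.log (1 + ε)) with hδε | hδε
  · have hR4 : R ^ 2 ≤ 1 / 4 := by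
      calc R ^ 2 ≤ (1 / 2) ^ 2 := by gcongr
        _ = 1 / 4 := by norm_num
    have hsub (j : Fin n) (s : ℕ) : HasSubgaussianMGF (fun ω => X j s ω - μ j) (1 / 4) P := by
      refine GroupedBandit.hasSubgaussianMGF_mono ?_ hR4
      have h := hsubD j
      rw [← hXD j s] at h
      exact h.of_map (hX j s).aemeasurable
    have hint (j : Fin n) (s : ℕ) : ∫ ω, (X j s ω - μ j) ∂P = 0 := by
      have hXint : Integrable (X j s) P :=
        ((hsub j s).integrable.add (integrable_const (μ j))).congr (ae_of_all _ fun ω => by simp)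
      rw [integral_sub hXint (integrable_const _), hμD j, ← hXD j s,
        integral_map (f := fun y => y) (hX j s).aemeasurable aestronglyMeasurable_id]
      simp
    set B := {ω | ¬ GroupedBandit.Concentrated ε (δ / n) (fun j s => X j s ω) μ} with hB
    have hPB : P.real (toMeasurable P B) ≤ 2 * (δ / Real.log (1 + ε) * S) := by
      rw [measureReal_def, measure_toMeasurable]
      exact ENNReal.toReal_le_of_le_ofReal (by positivity)
        (GroupedBandit.measure_not_concentrated_le hε0 hδ0 hδε hn hX hind hint hsub)
    -- Passing to a measurable hull of the bad set, of equal measure, avoids proving that set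
    -- measurable.
    refine ⟨(toMeasurable P B)ᶜ, (measurableSet_toMeasurable P B).compl, ?_, ?_⟩
    · rw [probReal_compl_eq_one_sub (measurableSet_toMeasurable P B)]
      have : (2 * S + 1) / Real.log (1 + ε) * δ =
          2 * (δ / Real.log (1 + ε) * S) + δ / Real.log (1 + ε) := by
        field_simp
      have : 0 ≤ δ / Real.log (1 + ε) := by positivity
      linarith
    · intro ω hω G a hrun T hT H hH
      have hc : GroupedBandit.Concentrated ε (δ / n) (fun j s => X j s ω) μ := by
        by_contra h
        exact hω (subset_toMeasurable P B h)
      exact GroupedBandit.simpleRegret_le_of_concentrated ⟨hε0, hε1⟩ hδ hn ⟨G₀, hG₀⟩ hG hμ hc hrun hT hH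
  · refine ⟨∅, MeasurableSet.empty, ?_, fun ω hω => absurd hω (Set.notMem_empty ω)⟩
    have : 1 ≤ (2 * S + 1) / Real.log (1 + ε) * δ := by
      rw [div_mul_eq_mul_div, one_le_div hlog]
      nlinarith
    simp only [measureReal_empty]
    linarith
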